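/- For $X=(x_1,\dots,x_n)\in B_n=\{0,1\}^n$ let $|X|=\sum_i x_i$ and $a_X=|X|/n$. A quantum algorithm with $T$ queries acts on finitely many qubits, split into an index register, one answer qubit and a workspace. It prepares $$|\psi_X\rangle=U_TQ_XU_{T-1}Q_X\cdots U_1Q_XU_0|\psi_0\rangle ,$$ where the unit vector $\psi_0$ and the unitary operators $U_0,\dots,U_T$ do not depend on $X$ and the query operator is $Q_X|i,b,z\rangle=|i,b\oplus x_i,z\rangle$ (acting as the identity when the index register addresses no variable). A single quantum measurement, independent of $X$, is then applied to $\psi_X$. It has finitely many outcomes, and outcome $j$ occurs with probability $p_X(j)$. On outcome $j$ the algorithm returns a real number $\hat a(j)$ as its approximation of $a_X$. For $\frac12<p\le 1$ the error on input $X$ and the average probabilistic error with respect to $\mu_2$ are $$e(X,T,p)=\inf\Big\{\gamma:\ \sum_{j:\,|a_X-\hat a(j)|\le\gamma}p_X(j)\ge p\Big\},\qquad e^{\mathrm{avg}}(B_n,T,p)=\sum_{X\in B_n}e(X,T,p)\,\mu_2(X),$$ where $\mu_2(X)=\dfrac{1}{(n+1)\binom{n}{|X|}}$ is the measure that makes all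 $n+1$ values of the mean equally likely. **Theorem 3.3.** There is an absolute constant $c>0$ such that the following two statements hold for every $p\in(\frac12,1]$. 1. Let $T=T(n)$ be $o(n)$. Then, for all sufficiently large $n$, every quantum algorithm with $T(n)$ queries satisfies $$e^{\mathrm{avg}}(B_n,T(n),p)\ \ge\ \frac{c}{\max\{T(n),1\}} ,$$ that is, the error is $\Omega(T^{-1})$ (and $\Omega(1)$ when no query is made). 2. Let $\varepsilon=\varepsilon(n)>0$ be $o(1)$. Then, for all sufficiently large $n$, every quantum algorithm whose average probabilistic error satisfies $e^{\mathrm{avg}}(B_n,t,p)\le\varepsilon(n)$ makes a number $t$ of queries with $$t\ \ge\ c\,\min\{\varepsilon(n)^{-1},n\}.$$ That is, the number of queries needed for error at most $\varepsilon$ is $\Omega(\min\{\varepsilon^{-1},n\})$. -/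

import Mathlib

open Filter Asymptotics
open scoped BigOperators

noncomputable section

namespace QuantumMean

/-- Tuples of `n` Boolean variables. -/
abbrev Input (n : ℕ) : Type := Fin n → Bool

/-- The number `|X|` of ones of `X`. -/
def weight {n : ℕ} (X : Input n) : ℕ := (Finset.univ.filter fun i => X i = true).card

/-- The Boolean mean `a_X = |X| / n`. -/
def mean {n : ℕ} (X : Input n) : ℝ := (weight X : ℝ) / n

/-- Computational basis of `ℓ + 1 + w` qubits, split into an index register of `ℓ` qubits,
one answer qubit, and a workspace of `w` qubits. -/
abbrev QIndex (ℓ w : ℕ) : Type := (Fin ℓ → Bool) × Bool × (Fin w → Bool)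

/-- The state space of `ℓ + 1 + w` qubits. -/
abbrev QState (ℓ w : ℕ) : Type := EuclideanSpace ℂ (QIndex ℓ w)

/-- The bit of `X` addressed by the content of the index register (`false` when the register
addresses no variable). -/
def addressedBit {n : ℕ} (X : Input n) (o : Option (Fin n)) : Bool :=
  match o with
  | none => false
  | some i => X i

/-- The permutation `(i, b, z) ↦ (i, b ⊕ x_i, z)` of the computational basis. -/
def queryPerm {n ℓ w : ℕ} (addr : (Fin ℓ → Bool) → Option (Fin n)) (X : Input n) :
    Equiv.Perm (QIndex ℓ w) where
  toFun s := (s.1, xor s.2.1 (addressedBit X (addr s.1)), s.2.2)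
  invFun s := (s.1, xor s.2.1 (addressedBit X (addr s.1)), s.2.2)
  left_inv s := by simp
  right_inv s := by simp

/-- The query operator `Q_X`: the unitary with `Q_X |i, b, z⟩ = |i, b ⊕ x_i, z⟩`. -/
def queryOp {n ℓ w : ℕ} (addr : (Fin ℓ → Bool) → Option (Fin n)) (X : Input n) :
    QState ℓ w ≃ₗᵢ[ℂ] QState ℓ w :=
  LinearIsometryEquiv.piLpCongrLeft 2 ℂ ℂ (queryPerm addr X)

/-- A quantum algorithm for inputs in `{0,1}ⁿ` that makes `T` queries and ends with a single
measurement. None of its data depends on the input. -/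
structure QueryAlgorithm (n T : ℕ) where
  /-- number of qubits of the index register -/
  ℓ : ℕ
  /-- number of qubits of the workspace -/
  w : ℕ
  /-- the variable that a basis state of the index register addresses; on basis states that
  address no variable a query acts as the identity -/
  addr : (Fin ℓ → Bool) → Option (Fin n)
  /-- the initial state `ψ₀` -/
  init : QState ℓ w
  norm_init : ‖init‖ = 1
  /-- the unitary transformations `U₀, …, U_T` -/
  U : Fin (T + 1) → (QState ℓ w ≃ₗᵢ[ℂ] QState ℓ w)
  /-- number of outcomes of the measurement -/
  M : ℕ
  /-- the measurement operators `K₀, …, K_{M-1}`, with `∑ K_j† K_j = 1` -/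
  meas : Fin M → (QState ℓ w →L[ℂ] QState ℓ w)
  meas_complete : ∑ j, (ContinuousLinearMap.adjoint (meas j)) ∘L (meas j) =
    ContinuousLinearMap.id ℂ (QState ℓ w)
  /-- the approximation of the mean that is returned on each outcome -/
  estimate : Fin M → ℝ

namespace QueryAlgorithm

variable {n T : ℕ}

/-- The state `U_k Q_X U_{k-1} Q_X ⋯ U₁ Q_X U₀ ψ₀`. -/
def state (A : QueryAlgorithm n T) (X : Input n) : Fin (T + 1) → QState A.ℓ A.w :=
  Fin.induction (A.U 0 A.init) fun k v => A.U k.succ (queryOp A.addr X v)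

/-- The final state `U_T Q_X U_{T-1} Q_X ⋯ U₁ Q_X U₀ ψ₀`. -/
def finalState (A : QueryAlgorithm n T) (X : Input n) : QState A.ℓ A.w :=
  A.state X (Fin.last T)

/-- The probability `p_X(j)` of outcome `j` on input `X`. -/
def prob (A : QueryAlgorithm n T) (X : Input n) (j : Fin A.M) : ℝ :=
  ‖A.meas j (A.finalState X)‖ ^ 2

open Classical in
/-- The local error
`e(X, T, p) = inf {γ : ∑_{j : |a_X - â(j)| ≤ γ} p_X(j) ≥ p}`. -/
def localError (A : QueryAlgorithm n T) (X : Input n) (p : ℝ) : ℝ :=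
  sInf {γ : ℝ |
    p ≤ ∑ j ∈ Finset.univ.filter (fun j => |mean X - A.estimate j| ≤ γ), A.prob X j}

/-- The average probabilistic error `∑_X e(X, T, p) μ(X)`. -/
def avgError (A : QueryAlgorithm n T) (μ : Input n → ℝ) (p : ℝ) : ℝ :=
  ∑ X : Input n, A.localError X p * μ X

end QueryAlgorithm

/-- The measure `μ₂(X) = 1 / ((n + 1) (n choose |X|))`. -/
def muTwo (n : ℕ) (X : Input n) : ℝ := 1 / (((n : ℝ) + 1) * (n.choose (weight X) : ℝ))

end QuantumMean

end

/-! Each query raises the degree of the amplitudes in the input bits by at most one, so outcome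
probabilities are polynomials of degree at most `2 * T`. Summed over the inputs of weight `k`, a
monomial depends only on its degree and on `k`; hence level averages, as functions of `k`, lie in a
space of dimension at most `2 * T + 1`.

Assign disjoint sets of outcomes to levels. The matrix of the average probability on one level of
the set of another is substochastic and factors through that space. Its eigenvalues have modulus at
most one and at most `2 * T + 1` of them are nonzero, so its trace, the total success over these
levels, is at most `2 * T + 1` (`sum_levelProb_le`).

Means of levels congruent mod `s` are at least `s / n` apart, so open balls of radius `s / (2 * n)`
about them are disjoint. Adding over the `s` residues bounds the total success over all levels by `s
* (2 * T + 1)`. For `s` of order `n / T` the average success probability is at most `1 / 4`, and a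
Markov inequality turns this into an average error of order `s / n`, that is `1 / T`. -/

namespace QuantumMean

/-! ### Multilinear polynomials on the Boolean cube -/

/-- The multilinear monomial `∏ i ∈ S, x_i`. -/
noncomputable def cubeMonomial {n : ℕ} (S : Finset (Fin n)) : Input n → ℂ :=
  fun X => if ∀ i ∈ S, X i = true then 1 else 0

/-- The functions on the Boolean cube of degree at most `d`. -/
noncomputable def degreeAtMost (n d : ℕ) : Submodule ℂ (Input n → ℂ) :=
  Submodule.span ℂ (cubeMonomial '' {S : Finset (Fin n) | S.card ≤ d})

theorem cubeMonomial_mul {n : ℕ} (S S' : Finset (Fin n)) :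
    cubeMonomial S * cubeMonomial S' = cubeMonomial (S ∪ S') := by
  funext X
  simp only [cubeMonomial, Pi.mul_apply, Finset.mem_union, or_imp, forall_and]
  split_ifs <;> simp_all

theorem cubeMonomial_mem_degreeAtMost {n d : ℕ} {S : Finset (Fin n)} (h : S.card ≤ d) :
    cubeMonomial S ∈ degreeAtMost n d :=
  Submodule.subset_span ⟨S, h, rfl⟩

theorem degreeAtMost_mono {n d d' : ℕ} (h : d ≤ d') : degreeAtMost n d ≤ degreeAtMost n d' :=
  Submodule.span_mono (Set.image_mono fun _ hS => le_trans hS h)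

theorem const_mem_degreeAtMost {n d : ℕ} (a : ℂ) :
    (fun _ : Input n => a) ∈ degreeAtMost n d := by
  have h := (degreeAtMost n d).smul_mem a
    (cubeMonomial_mem_degreeAtMost (S := (∅ : Finset (Fin n))) (by simp))
  convert h using 1
  funext X
  simp [cubeMonomial]

theorem mul_mem_degreeAtMost {n d d' : ℕ} {f g : Input n → ℂ} (hf : f ∈ degreeAtMost n d)
    (hg : g ∈ degreeAtMost n d') : f * g ∈ degreeAtMost n (d + d') := by
  have hle : degreeAtMost n d * degreeAtMost n d' ≤ degreeAtMost n (d + d') := by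
    rw [degreeAtMost, degreeAtMost, Submodule.span_mul_span, Submodule.span_le]
    rintro _ ⟨_, ⟨S, hS, rfl⟩, _, ⟨S', hS', rfl⟩, rfl⟩
    simp only [cubeMonomial_mul]
    exact cubeMonomial_mem_degreeAtMost
      ((Finset.card_union_le S S').trans (Nat.add_le_add hS hS'))
  exact hle (Submodule.mul_mem_mul hf hg)

theorem star_mem_degreeAtMost {n d : ℕ} {f : Input n → ℂ} (hf : f ∈ degreeAtMost n d) :
    star f ∈ degreeAtMost n d := by
  induction hf using Submodule.span_induction with
  | mem f hf =>
    obtain ⟨S, hS, rfl⟩ := hf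
    convert cubeMonomial_mem_degreeAtMost hS using 1
    funext X
    simp only [cubeMonomial, Pi.star_apply]
    split_ifs <;> simp
  | zero => simp
  | add f g _ _ hf hg => rw [star_add]; exact add_mem hf hg
  | smul a f _ hf => rw [star_smul]; exact Submodule.smul_mem _ _ hf

/-! ### Symmetrization -/

/-- The sum of a function over the inputs with `k` ones. -/
noncomputable def levelSum {n : ℕ} (k : ℕ) (f : Input n → ℂ) : ℂ :=
  ∑ X : Input n with weight X = k, f X

theorem weight_comp_perm {n : ℕ} (σ : Equiv.Perm (Fin n)) (X : Input n) :
    weight (X ∘ σ) = weight X :=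
  Finset.card_equiv σ (by simp)

/-- A permutation of the variables carrying `S` to `S'` preserves every level of the cube. -/
theorem levelSum_cubeMonomial_congr {n k : ℕ} {S S' : Finset (Fin n)} (h : S.card = S'.card) :
    levelSum k (cubeMonomial S) = levelSum k (cubeMonomial S') := by
  let e : {i // i ∈ S} ≃ {i // i ∈ S'} := Finset.equivOfCardEq h
  let σ : Equiv.Perm (Fin n) := e.extendSubtype
  have hσ : ∀ i, σ i ∈ S' ↔ i ∈ S := fun i => by
    by_cases hi : i ∈ S
    · simpa [hi] using e.extendSubtype_mem i hi
    · simpa [hi] using e.extendSubtype_not_mem i hi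
  refine (Finset.sum_equiv (σ.arrowCongr (Equiv.refl Bool)).symm ?_ ?_).symm
  · intro X
    have := weight_comp_perm σ X
    simpa [Equiv.arrowCongr, Function.comp_def] using by rw [← this]; rfl
  · intro X _
    have : (∀ i ∈ S', X i = true) ↔ ∀ i ∈ S, X (σ i) = true := by
      rw [← σ.forall_congr_right]
      simp [hσ]
    simp [cubeMonomial, Equiv.arrowCongr, this]

/-- The common value of `levelSum k` on the monomials of degree `s`. -/
noncomputable def monomialLevelSum (n s k : ℕ) : ℂ :=
  levelSum k (cubeMonomial (Finset.univ.filter fun i : Fin n => (i : ℕ) < s))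

theorem levelSum_cubeMonomial {n k : ℕ} (S : Finset (Fin n)) :
    levelSum k (cubeMonomial S) = monomialLevelSum n S.card k := by
  refine levelSum_cubeMonomial_congr ?_
  have hS : S.card ≤ n := by simpa using S.card_le_univ
  rw [Fin.card_filter_val_lt, min_eq_right hS]

/-- The level sums of the functions of degree at most `d` span at most `d + 1` dimensions. -/
theorem exists_levelSum_eq {n d : ℕ} {f : Input n → ℂ} (hf : f ∈ degreeAtMost n d) :
    ∃ b : Fin (d + 1) → ℂ, ∀ k, levelSum k f = ∑ s : Fin (d + 1), monomialLevelSum n s k * b s := by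
  induction hf using Submodule.span_induction with
  | mem f hf =>
    obtain ⟨S, hS, rfl⟩ := hf
    -- The coefficients do not depend on `k`; this is what later gives a matrix factorization.
    refine ⟨Pi.single ⟨S.card, Nat.lt_succ_of_le hS⟩ 1, fun k => ?_⟩
    simp [Pi.single_apply, levelSum_cubeMonomial]
  | zero => exact ⟨0, fun k => by simp [levelSum]⟩
  | add f g _ _ hf hg =>
    obtain ⟨b, hb⟩ := hf
    obtain ⟨b', hb'⟩ := hg
    refine ⟨b + b', fun k => ?_⟩
    simp only [Pi.add_apply, mul_add, Finset.sum_add_distrib, ← hb, ← hb']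
    simp [levelSum, Finset.sum_add_distrib]
  | smul a f _ hf =>
    obtain ⟨b, hb⟩ := hf
    refine ⟨a • b, fun k => ?_⟩
    simp only [Pi.smul_apply, smul_eq_mul, mul_left_comm _ a, ← Finset.mul_sum, ← hb]
    simp [levelSum, Finset.mul_sum]

/-! ### Traces of substochastic matrices of small rank -/

/-- Compare both sides at a coordinate where `‖v i‖` is largest. -/
theorem norm_le_one_of_mulVec_eq_smul {ι : Type*} [Fintype ι] {M : Matrix ι ι ℂ}
    (hM : ∀ i, ∑ j, ‖M i j‖ ≤ 1) {μ : ℂ} {v : ι → ℂ} (hv : v ≠ 0)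
    (h : M.mulVec v = μ • v) : ‖μ‖ ≤ 1 := by
  obtain ⟨i₀, hi₀⟩ := Function.ne_iff.mp hv
  have : Nonempty ι := ⟨i₀⟩
  obtain ⟨i, hi⟩ := Finite.exists_max fun i => ‖v i‖
  have hpos : 0 < ‖v i‖ := (norm_pos_iff.mpr hi₀).trans_le (hi i₀)
  have hle : ‖μ‖ * ‖v i‖ ≤ 1 * ‖v i‖ := by
    calc ‖μ‖ * ‖v i‖ = ‖M.mulVec v i‖ := by rw [h]; simp
      _ ≤ ∑ j, ‖M i j * v j‖ := norm_sum_le _ _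
      _ ≤ ∑ j, ‖M i j‖ * ‖v i‖ := by
        refine Finset.sum_le_sum fun j _ => ?_
        rw [norm_mul]
        exact mul_le_mul_of_nonneg_left (hi j) (norm_nonneg _)
      _ ≤ 1 * ‖v i‖ := by
        rw [← Finset.sum_mul]
        exact mul_le_mul_of_nonneg_right (hM i) hpos.le
  exact le_of_mul_le_mul_right hle hpos

/-- A matrix whose absolute row sums are at most one and which factors through a space of
dimension `D` has trace at most `D`. -/
theorem norm_trace_mul_le {ι κ : Type*} [Fintype ι] [Fintype κ] [DecidableEq κ]
    (A : Matrix ι κ ℂ) (B : Matrix κ ι ℂ) (h : ∀ i, ∑ j, ‖(A * B) i j‖ ≤ 1) :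
    ‖(A * B).trace‖ ≤ Fintype.card κ := by
  -- `B * A` has the same trace but only `Fintype.card κ` eigenvalues.
  rw [Matrix.trace_mul_comm, Matrix.trace_eq_sum_roots_charpoly]
  have hroot : ∀ μ ∈ (B * A).charpoly.roots, ‖μ‖ ≤ 1 := by
    intro μ hμ
    rw [Polynomial.mem_roots (B * A).charpoly_monic.ne_zero,
      ← Matrix.mem_spectrum_iff_isRoot_charpoly, ← Matrix.spectrum_toLin',
      ← Module.End.hasEigenvalue_iff_mem_spectrum] at hμ
    obtain ⟨v, hv⟩ := hμ.exists_hasEigenvector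
    have hBA : B.mulVec (A.mulVec v) = μ • v := by
      have := hv.apply_eq_smul
      rwa [Matrix.toLin'_apply, ← Matrix.mulVec_mulVec] at this
    -- Either `μ = 0`, or `A.mulVec v` is an eigenvector of `A * B` for the same `μ`.
    by_cases hA : A.mulVec v = 0
    · rw [hA, Matrix.mulVec_zero, eq_comm, smul_eq_zero] at hBA
      simp [hBA.resolve_right hv.2]
    · refine norm_le_one_of_mulVec_eq_smul h hA ?_
      rw [← Matrix.mulVec_mulVec, hBA, Matrix.mulVec_smul]
  calc ‖(B * A).charpoly.roots.sum‖
      ≤ ((B * A).charpoly.roots.map fun μ => ‖μ‖).sum := norm_multiset_sum_le _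
    _ ≤ (((B * A).charpoly.roots.map fun μ => ‖μ‖).card) • (1 : ℝ) :=
      by
        refine Multiset.sum_le_card_nsmul _ _ fun x hx => ?_
        obtain ⟨μ, hμ, rfl⟩ := Multiset.mem_map.mp hx
        exact hroot μ hμ
    _ ≤ Fintype.card κ := by
      rw [Multiset.card_map, nsmul_eq_mul, mul_one]
      exact_mod_cast (Polynomial.card_roots' _).trans (B * A).charpoly_natDegree_eq_dim.le

/-! ### Acceptance probabilities are polynomials -/

theorem addressedBit_mem_degreeAtMost {n : ℕ} (o : Option (Fin n)) :
    (fun X : Input n => if addressedBit X o = true then (1 : ℂ) else 0) ∈ degreeAtMost n 1 := by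
  cases o with
  | none => simpa [addressedBit] using const_mem_degreeAtMost (n := n) (d := 1) 0
  | some i =>
    convert cubeMonomial_mem_degreeAtMost (S := {i}) (d := 1) (by simp) using 1
    funext X
    by_cases h : X i = true <;> simp [cubeMonomial, addressedBit, h]

/-- Written as an affine function of the addressed bit, a query visibly raises the degree by at most
one. -/
theorem queryOp_apply {n ℓ w : ℕ} (addr : (Fin ℓ → Bool) → Option (Fin n)) (X : Input n)
    (v : QState ℓ w) (s : QIndex ℓ w) :
    queryOp addr X v s = (if addressedBit X (addr s.1) = true then (1 : ℂ) else 0) *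
      (v (s.1, !s.2.1, s.2.2) - v s) + v s := by
  have h : queryOp addr X v s = v (s.1, xor s.2.1 (addressedBit X (addr s.1)), s.2.2) := rfl
  rw [h]
  cases addressedBit X (addr s.1) <;> simp

theorem linear_apply_mem_degreeAtMost {n d : ℕ} {κ : Type*} [Fintype κ]
    {F : Input n → EuclideanSpace ℂ κ} (hF : ∀ s, (fun X => F X s) ∈ degreeAtMost n d)
    (φ : EuclideanSpace ℂ κ →ₗ[ℂ] ℂ) : (fun X => φ (F X)) ∈ degreeAtMost n d := by
  classical
  have h : (fun X => φ (F X)) =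
      ∑ s, φ (EuclideanSpace.basisFun κ ℂ s) • fun X => F X s := by
    funext X
    conv_lhs => rw [← (EuclideanSpace.basisFun κ ℂ).sum_repr (F X)]
    simp [mul_comm]
  rw [h]
  exact Submodule.sum_mem _ fun s _ => Submodule.smul_mem _ _ (hF s)

namespace QueryAlgorithm

variable {n T : ℕ}

theorem state_mem_degreeAtMost (A : QueryAlgorithm n T) (k : Fin (T + 1)) :
    ∀ s, (fun X => A.state X k s) ∈ degreeAtMost n k := by
  induction k using Fin.induction with
  | zero => exact fun s => const_mem_degreeAtMost (A.U 0 A.init s)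
  | succ k ih =>
    intro s
    have hq : ∀ s, (fun X => queryOp A.addr X (A.state X k.castSucc) s) ∈
        degreeAtMost n (k + 1) := by
      intro s
      simp only [queryOp_apply]
      refine add_mem ?_ (degreeAtMost_mono (Nat.le_succ _) (ih s))
      rw [add_comm]
      exact mul_mem_degreeAtMost (addressedBit_mem_degreeAtMost _) (sub_mem (ih _) (ih s))
    exact linear_apply_mem_degreeAtMost hq
      ((EuclideanSpace.proj s : QState A.ℓ A.w →L[ℂ] ℂ).toLinearMap ∘ₗ
        (A.U k.succ).toLinearEquiv.toLinearMap)

theorem prob_mem_degreeAtMost (A : QueryAlgorithm n T) (j : Fin A.M) :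
    (fun X => (A.prob X j : ℂ)) ∈ degreeAtMost n (2 * T) := by
  have hm : ∀ s, (fun X => A.meas j (A.finalState X) s) ∈ degreeAtMost n T := fun s =>
    linear_apply_mem_degreeAtMost (A.state_mem_degreeAtMost (Fin.last T))
      ((EuclideanSpace.proj s : QState A.ℓ A.w →L[ℂ] ℂ).toLinearMap ∘ₗ (A.meas j).toLinearMap)
  have h : (fun X => (A.prob X j : ℂ)) =
      ∑ s, (fun X => A.meas j (A.finalState X) s) *
        star fun X => A.meas j (A.finalState X) s := by
    funext X
    simp [prob, EuclideanSpace.norm_sq_eq, Complex.mul_conj, Complex.normSq_eq_norm_sq]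
  rw [h, two_mul]
  exact Submodule.sum_mem _ fun s _ => mul_mem_degreeAtMost (hm s) (star_mem_degreeAtMost (hm s))

theorem norm_state (A : QueryAlgorithm n T) (X : Input n) (k : Fin (T + 1)) :
    ‖A.state X k‖ = 1 := by
  induction k using Fin.induction with
  | zero => simpa [state] using A.norm_init
  | succ k ih =>
    have : A.state X k.succ = A.U k.succ (queryOp A.addr X (A.state X k.castSucc)) := rfl
    rw [this, LinearIsometryEquiv.norm_map, LinearIsometryEquiv.norm_map, ih]

theorem prob_nonneg (A : QueryAlgorithm n T) (X : Input n) (j : Fin A.M) : 0 ≤ A.prob X j :=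
  sq_nonneg _

theorem sum_prob (A : QueryAlgorithm n T) (X : Input n) : ∑ j, A.prob X j = 1 := by
  have h : ∀ v : QState A.ℓ A.w, ∑ j, ‖A.meas j v‖ ^ 2 = ‖v‖ ^ 2 := by
    intro v
    -- Pair the completeness relation, applied to `v`, with `v` itself.
    have hv := congrArg (fun L : QState A.ℓ A.w →L[ℂ] QState A.ℓ A.w =>
      RCLike.re (inner ℂ (L v) v)) A.meas_complete
    simp only [sum_apply, ContinuousLinearMap.comp_apply, sum_inner,
      ContinuousLinearMap.adjoint_inner_left, ContinuousLinearMap.id_apply, map_sum,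
      inner_self_eq_norm_sq] at hv
    exact hv
  have hX : ‖A.finalState X‖ = 1 := A.norm_state X _
  simp [prob, h, hX]

end QueryAlgorithm

/-! ### Levels of the cube and the measure `muTwo` -/

theorem card_filter_weight_eq (n k : ℕ) :
    (Finset.univ.filter fun X : Input n => weight X = k).card = n.choose k := by
  have h := Finset.card_powersetCard k (Finset.univ : Finset (Fin n))
  rw [Finset.card_univ, Fintype.card_fin] at h
  rw [← h]
  refine Finset.card_bij' (fun X _ => Finset.univ.filter fun i => X i = true)
    (fun S _ i => decide (i ∈ S)) ?_ ?_ ?_ ?_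
  · intro X hX
    exact Finset.mem_powersetCard.mpr ⟨Finset.subset_univ _, (Finset.mem_filter.mp hX).2⟩
  · intro S hS
    refine Finset.mem_filter.mpr ⟨Finset.mem_univ _, ?_⟩
    simpa [weight] using (Finset.mem_powersetCard.mp hS).2
  · intro X _
    funext i
    simp
  · intro S _
    ext i
    simp

theorem weight_le {n : ℕ} (X : Input n) : weight X ≤ n :=
  (Finset.card_le_univ _).trans_eq (Fintype.card_fin n)

theorem sum_input_eq_sum_weight {n : ℕ} (f : Input n → ℝ) :
    ∑ X, f X = ∑ k ∈ Finset.range (n + 1), ∑ X : Input n with weight X = k, f X :=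
  (Finset.sum_fiberwise_of_maps_to (fun X _ =>
    Finset.mem_range.mpr (Nat.lt_succ_of_le (weight_le X))) f).symm

/-- Integration against `muTwo` is the uniform average of the level averages, the form in which the
trace bound applies. -/
theorem sum_mul_muTwo {n : ℕ} (f : Input n → ℝ) :
    ∑ X, f X * muTwo n X = (∑ k ∈ Finset.range (n + 1),
      (n.choose k : ℝ)⁻¹ * ∑ X : Input n with weight X = k, f X) / (n + 1) := by
  rw [sum_input_eq_sum_weight, Finset.sum_div]
  refine Finset.sum_congr rfl fun k _ => ?_
  rw [Finset.mul_sum, Finset.sum_div]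
  refine Finset.sum_congr rfl fun X hX => ?_
  rw [muTwo, (Finset.mem_filter.mp hX).2, one_div, mul_inv]
  ring

theorem muTwo_nonneg {n : ℕ} (X : Input n) : 0 ≤ muTwo n X := by
  unfold muTwo
  positivity

theorem sum_muTwo (n : ℕ) : ∑ X, muTwo n X = 1 := by
  have h := sum_mul_muTwo (n := n) fun _ => 1
  simp only [one_mul, Finset.sum_const, card_filter_weight_eq, nsmul_eq_mul, mul_one] at h
  rw [h, Finset.sum_congr rfl fun k hk => inv_mul_cancel₀ (Nat.cast_ne_zero.mpr
    (Nat.choose_pos (Nat.lt_succ_iff.mp (Finset.mem_range.mp hk))).ne')]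
  simp only [Finset.sum_const, Finset.card_range, nsmul_eq_mul, mul_one]
  push_cast
  exact div_self (by positivity)

/-! ### Trace bound, packing of levels and the error estimate -/

namespace QueryAlgorithm

variable {n T : ℕ}

/-- If disjoint sets of outcomes are assigned to levels of the cube, then their averaged
probabilities on these levels add up to at most `2 * T + 1`. -/
theorem sum_levelProb_le (A : QueryAlgorithm n T) {ι : Type*} [Fintype ι] (wt : ι → ℕ)
    (hwt : ∀ i, wt i ≤ n) (E : ι → Finset (Fin A.M))
    (hE : Pairwise fun i i' => Disjoint (E i) (E i')) :
    ∑ i, (n.choose (wt i) : ℝ)⁻¹ *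
      ∑ X : Input n with weight X = wt i, ∑ j ∈ E i, A.prob X j ≤ 2 * T + 1 := by
  classical
  have hdeg : ∀ i, (fun X => ∑ j ∈ E i, (A.prob X j : ℂ)) ∈ degreeAtMost n (2 * T) := by
    intro i
    have := Submodule.sum_mem (degreeAtMost n (2 * T)) (t := E i) fun j _ =>
      A.prob_mem_degreeAtMost j
    convert this using 1
    funext X
    simp
  choose b hb using fun i => exists_levelSum_eq (hdeg i)
  let m : ι → ι → ℝ := fun i i' => (n.choose (wt i) : ℝ)⁻¹ *
    ∑ X : Input n with weight X = wt i, ∑ j ∈ E i', A.prob X j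
  -- `P` sees only the level and `R` only the outcome set, so `m = P * R` has rank at most `2 * T +
  -- 1`.
  let P : Matrix ι (Fin (2 * T + 1)) ℂ := fun i s =>
    (n.choose (wt i) : ℂ)⁻¹ * monomialLevelSum n s (wt i)
  let R : Matrix (Fin (2 * T + 1)) ι ℂ := fun s i => b i s
  have hm0 : ∀ i i', 0 ≤ m i i' := fun i i' =>
    mul_nonneg (by positivity) (Finset.sum_nonneg fun X _ => Finset.sum_nonneg fun j _ =>
      A.prob_nonneg X j)
  have hPR : ∀ i i', (P * R) i i' = (m i i' : ℂ) := by
    intro i i'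
    rw [Matrix.mul_apply]
    simp only [P, R, mul_assoc, ← Finset.mul_sum, ← hb, m, levelSum]
    push_cast
    rfl
  have hrow : ∀ i, ∑ i', ‖(P * R) i i'‖ ≤ 1 := by
    intro i
    have hX : ∀ X, ∑ i', ∑ j ∈ E i', A.prob X j ≤ 1 := by
      intro X
      rw [← Finset.sum_biUnion fun i _ i' _ h => hE h, ← A.sum_prob X]
      exact Finset.sum_le_sum_of_subset_of_nonneg (Finset.subset_univ _) fun j _ _ =>
        A.prob_nonneg X j
    simp only [hPR, Complex.norm_real, Real.norm_of_nonneg (hm0 _ _), m]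
    rw [← Finset.mul_sum, Finset.sum_comm]
    have hpos : (0 : ℝ) < n.choose (wt i) := Nat.cast_pos.mpr (Nat.choose_pos (hwt i))
    rw [inv_mul_le_iff₀ hpos, mul_one, ← card_filter_weight_eq]
    exact (Finset.sum_le_sum fun X _ => hX X).trans (by simp)
  have htr : (P * R).trace = ((∑ i, m i i : ℝ) : ℂ) := by
    simp [Matrix.trace, hPR]
  have h := norm_trace_mul_le P R hrow
  rw [htr, Complex.norm_real, Fintype.card_fin] at h
  exact_mod_cast (le_abs_self _).trans h

/-- The probability that the estimate deviates from the mean by less than `γ`. -/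
noncomputable def hitProb (A : QueryAlgorithm n T) (γ : ℝ) (X : Input n) : ℝ :=
  ∑ j with |mean X - A.estimate j| < γ, A.prob X j

theorem nonneg_of_le_sum_prob (A : QueryAlgorithm n T) (X : Input n) {p : ℝ} (hp : 0 < p) {γ : ℝ}
    (hγ : p ≤ ∑ j with |mean X - A.estimate j| ≤ γ, A.prob X j) : 0 ≤ γ := by
  by_contra! h
  rw [Finset.filter_false_of_mem fun j _ hj => absurd ((abs_nonneg _).trans hj) h.not_ge,
    Finset.sum_empty] at hγ
  exact hp.not_ge hγ

theorem localError_eq (A : QueryAlgorithm n T) (X : Input n) (p : ℝ) :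
    A.localError X p =
      sInf {γ : ℝ | p ≤ ∑ j with |mean X - A.estimate j| ≤ γ, A.prob X j} := by
  unfold localError
  congr!

theorem localError_nonneg (A : QueryAlgorithm n T) (X : Input n) {p : ℝ} (hp : 0 < p) :
    0 ≤ A.localError X p := by
  rw [localError_eq]
  exact Real.sInf_nonneg fun γ hγ => A.nonneg_of_le_sum_prob X hp hγ

/-- Some admissible radius lies strictly below `γ`, so it is not needed that the infimum is
attained. -/
theorem le_hitProb (A : QueryAlgorithm n T) (X : Input n) {p γ : ℝ} (hp1 : p ≤ 1)
    (h : A.localError X p < γ) : p ≤ A.hitProb γ X := by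
  have hne : {γ : ℝ | p ≤ ∑ j with |mean X - A.estimate j| ≤ γ, A.prob X j}.Nonempty := by
    -- This radius dominates every deviation, so it captures total probability `1 ≥ p`.
    refine ⟨∑ j, |mean X - A.estimate j|, ?_⟩
    rw [Set.mem_ofPred_eq, Finset.filter_true_of_mem fun j _ =>
      Finset.single_le_sum (f := fun j => |mean X - A.estimate j|)
        (fun j _ => abs_nonneg _) (Finset.mem_univ j), A.sum_prob]
    exact hp1
  rw [localError_eq] at h
  obtain ⟨γ', hγ', hlt⟩ := exists_lt_of_csInf_lt hne h
  refine hγ'.trans (Finset.sum_le_sum_of_subset_of_nonneg ?_ fun j _ _ => A.prob_nonneg X j)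
  exact Finset.monotone_filter_right _ fun j _ hj => lt_of_le_of_lt hj hlt

/-- A Markov type inequality for the average probabilistic error. -/
theorem le_sum_hitProb (A : QueryAlgorithm n T) {p γ : ℝ} (hp : 0 < p) (hp1 : p ≤ 1)
    (hγ : 0 < γ) :
    p * (1 - A.avgError (muTwo n) p / γ) ≤ ∑ X, A.hitProb γ X * muTwo n X := by
  -- If the local error is at least `γ` the left side is nonpositive; otherwise it is at most `p`.
  have hX : ∀ X, p * (1 - A.localError X p / γ) ≤ A.hitProb γ X := by
    intro X
    rcases lt_or_ge (A.localError X p) γ with h | h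
    · refine le_trans ?_ (A.le_hitProb X hp1 h)
      have : 0 ≤ A.localError X p / γ := div_nonneg (A.localError_nonneg X hp) hγ.le
      nlinarith
    · have : 1 ≤ A.localError X p / γ := (one_le_div hγ).mpr h
      have h0 : 0 ≤ A.hitProb γ X := Finset.sum_nonneg fun j _ => A.prob_nonneg X j
      nlinarith
  calc p * (1 - A.avgError (muTwo n) p / γ)
      = ∑ X, p * (1 - A.localError X p / γ) * muTwo n X := by
        conv_lhs => rw [← sum_muTwo n]
        rw [avgError, Finset.sum_div, ← Finset.sum_sub_distrib, Finset.mul_sum]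
        exact Finset.sum_congr rfl fun X _ => by ring
    _ ≤ _ := Finset.sum_le_sum fun X _ => mul_le_mul_of_nonneg_right (hX X) (muTwo_nonneg X)

theorem sum_hitProb_le (A : QueryAlgorithm n T) (hn : 0 < n) {s : ℕ} (hs : 0 < s) :
    (∑ X, A.hitProb (s / (2 * n)) X * muTwo n X) * (n + 1) ≤ s * (2 * T + 1) := by
  have hn' : (0 : ℝ) < n := Nat.cast_pos.mpr hn
  -- Group the levels by residue mod `s`; each class contributes at most `2 * T + 1`.
  rw [sum_mul_muTwo, div_mul_cancel₀ _ (by positivity),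
    ← Finset.sum_fiberwise_of_maps_to (g := fun k => k % s) (t := Finset.range s)
      fun k _ => Finset.mem_range.mpr (Nat.mod_lt k hs)]
  refine (Finset.sum_le_card_nsmul _ _ (2 * T + 1 : ℝ) fun r _ => ?_).trans
    (by rw [Finset.card_range, nsmul_eq_mul])
  let K := (Finset.range (n + 1)).filter fun k => k % s = r
  let E : K → Finset (Fin A.M) := fun k =>
    Finset.univ.filter fun j => |(k : ℕ) / (n : ℝ) - A.estimate j| < s / (2 * n)
  have hE : Pairwise fun k k' => Disjoint (E k) (E k') := by
    intro k k' hne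
    have key : ∀ a b : K, (a : ℕ) < b → Disjoint (E a) (E b) := by
      intro a b hab
      rw [Finset.disjoint_left]
      intro j ha hb
      have ha := abs_lt.mp (Finset.mem_filter.mp ha).2
      have hb := abs_lt.mp (Finset.mem_filter.mp hb).2
      have hmod : (a : ℕ) ≡ b [MOD s] :=
        (Finset.mem_filter.mp a.2).2.trans (Finset.mem_filter.mp b.2).2.symm
      have hle : s ≤ (b : ℕ) - a :=
        Nat.le_of_dvd (Nat.sub_pos_of_lt hab) ((Nat.modEq_iff_dvd' hab.le).mp hmod)
      have hle' : (s : ℝ) + (a : ℕ) ≤ (b : ℕ) := by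
        exact_mod_cast (by omega : s + (a : ℕ) ≤ b)
      have hdiv : (s : ℝ) / n + (a : ℕ) / n ≤ (b : ℕ) / n := by
        rw [← add_div]
        exact div_le_div_of_nonneg_right hle' hn'.le
      have hhalf : (s : ℝ) / (2 * n) + s / (2 * n) = s / n := by
        field_simp
        ring
      linarith [ha.1, hb.2]
    rcases lt_or_gt_of_ne (Subtype.coe_injective.ne hne) with h | h
    · exact key k k' h
    · exact (key k' k h).symm
  have h := A.sum_levelProb_le (fun k : K => (k : ℕ)) (fun k => Nat.lt_succ_iff.mp
    (Finset.mem_range.mp (Finset.mem_filter.mp k.2).1)) E hE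
  rw [← Finset.sum_coe_sort]
  refine le_trans (le_of_eq ?_) h
  refine Finset.sum_congr rfl fun k _ => ?_
  congr 1
  refine Finset.sum_congr rfl fun X hX => ?_
  simp only [hitProb, mean, (Finset.mem_filter.mp hX).2, E]

/-- The average error is of order at least `1 / T` as long as `T` is small compared to `n`. -/
theorem avgError_lower_bound (A : QueryAlgorithm n T) {p : ℝ} (hp : 1 / 2 < p) (hp1 : p ≤ 1)
    (h : 4 * (2 * T + 1) ≤ n + 1) :
    1 / 96 / max (T : ℝ) 1 ≤ A.avgError (muTwo n) p := by
  have hn : 0 < n := by omega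
  have hn' : (0 : ℝ) < n := Nat.cast_pos.mpr hn
  -- The largest `s` with `s * (2 * T + 1) ≤ (n + 1) / 4`. As `s ≥ 1`, rounding down costs at most a
  -- factor of two.
  set s := (n + 1) / (4 * (2 * T + 1)) with hsdef
  have hs : 0 < s := Nat.div_pos h (by positivity)
  have hs' : (0 : ℝ) < s := Nat.cast_pos.mpr hs
  have hup : (s : ℝ) * (4 * (2 * T + 1)) ≤ n + 1 := by
    exact_mod_cast Nat.div_mul_le_self (n + 1) (4 * (2 * T + 1))
  have hlow : (n : ℝ) + 1 ≤ 2 * s * (4 * (2 * T + 1)) := by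
    have h1 : n + 1 < (s + 1) * (4 * (2 * T + 1)) := by
      rw [mul_comm]
      exact Nat.lt_mul_div_succ (n + 1) (by positivity)
    have h2 : n + 1 ≤ 2 * s * (4 * (2 * T + 1)) :=
      h1.le.trans (Nat.mul_le_mul_right _ (by omega))
    exact_mod_cast h2
  set γ : ℝ := s / (2 * n) with hγdef
  have hγ : 0 < γ := by positivity
  set e := A.avgError (muTwo n) p
  have hmain : p * (1 - e / γ) * (n + 1) ≤ (n + 1) / 4 := by
    have h1 := A.le_sum_hitProb (by linarith : 0 < p) hp1 hγ
    have h2 := A.sum_hitProb_le hn hs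
    have h3 := mul_le_mul_of_nonneg_right h1 (by positivity : (0 : ℝ) ≤ n + 1)
    linarith
  have he : 1 / 2 ≤ e / γ := by
    have h1 : p * (1 - e / γ) ≤ 1 / 4 := by
      refine le_of_mul_le_mul_right (hmain.trans (by linarith)) (by positivity : (0 : ℝ) < n + 1)
    by_contra! hlt
    nlinarith
  rw [le_div_iff₀ hγ] at he
  refine le_trans ?_ he
  have hmax : (2 * T + 1 : ℝ) ≤ 3 * max (T : ℝ) 1 := by
    linarith [le_max_left (T : ℝ) 1, le_max_right (T : ℝ) 1]
  have hmpos : (0 : ℝ) < max (T : ℝ) 1 := lt_max_of_lt_right one_pos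
  rw [hγdef, div_le_iff₀ hmpos]
  -- `24 = 2 * 4 * 3` from `hlow` and `hmax`; with the error bound `s / (4 * n)` this gives `96 = 4
  -- * 24`.
  have hgoal : (n : ℝ) ≤ 24 * s * max (T : ℝ) 1 := by nlinarith
  have heq : 1 / 2 * ((s : ℝ) / (2 * n)) * max (T : ℝ) 1 = (s * max (T : ℝ) 1) / (4 * n) := by
    field_simp
    ring
  rw [heq, le_div_iff₀ (by positivity)]
  linarith

end QueryAlgorithm
end QuantumMean

/-! ### Asymptotic statements -/

theorem theorem3p3 :
    (∃ c : ℝ, 0 < c ∧ ∀ p : ℝ, 1 / 2 < p → p ≤ 1 →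
      ∀ T : ℕ → ℕ, (fun n => (T n : ℝ)) =o[atTop] (fun n : ℕ => (n : ℝ)) →
        ∀ᶠ n : ℕ in atTop, ∀ A : QuantumMean.QueryAlgorithm n (T n),
          c / max (T n : ℝ) 1 ≤ A.avgError (QuantumMean.muTwo n) p) ∧
    (∃ c : ℝ, 0 < c ∧ ∀ p : ℝ, 1 / 2 < p → p ≤ 1 →
      ∀ ε : ℕ → ℝ, (∀ n, 0 < ε n) → ε =o[atTop] (fun _ : ℕ => (1 : ℝ)) →
        ∀ᶠ n : ℕ in atTop, ∀ (t : ℕ) (A : QuantumMean.QueryAlgorithm n t),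
          A.avgError (QuantumMean.muTwo n) p ≤ ε n → c * min (ε n)⁻¹ (n : ℝ) ≤ (t : ℝ)) := by
  refine ⟨⟨1 / 96, by norm_num, fun p hp hp1 T hT => ?_⟩,
    ⟨1 / 96, by norm_num, fun p hp hp1 ε hε0 hε => ?_⟩⟩
  -- From `16 * T n ≤ n` and `6 ≤ n` follows `8 * T n + 4 ≤ n + 1`.
  · filter_upwards [hT.def (by norm_num : (0 : ℝ) < 1 / 16), eventually_ge_atTop 6] with n hn hn6 A
    refine A.avgError_lower_bound hp hp1 ?_
    simp only [Real.norm_natCast] at hn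
    have : 16 * T n ≤ n := by
      have : (16 : ℝ) * T n ≤ n := by linarith
      exact_mod_cast this
    omega
  · filter_upwards [hε.def (by norm_num : (0 : ℝ) < 1 / 192), eventually_ge_atTop 6]
      with n hn hn6 t A hA
    have hn6' : (6 : ℝ) ≤ n := by exact_mod_cast hn6
    rw [Real.norm_of_nonneg (hε0 n).le, norm_one, mul_one] at hn
    by_cases ht : 4 * (2 * t + 1) ≤ n + 1
    · have h := (A.avgError_lower_bound hp hp1 ht).trans hA
      rw [div_le_iff₀ (lt_max_of_lt_right one_pos)] at h
      -- Without queries the error would be at least `1 / 96`, but `ε n ≤ 1 / 192`.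
      have htm : 1 ≤ (t : ℝ) := by
        by_contra! hlt
        rw [max_eq_right hlt.le] at h
        linarith
      rw [max_eq_left htm, ← div_le_iff₀' (hε0 n), div_eq_mul_inv] at h
      exact (mul_le_mul_of_nonneg_left (min_le_left _ _) (by norm_num)).trans h
    -- Here `t` is already linear in `n`, which gives the `n` in the minimum.
    · have h8 : (n : ℝ) ≤ 8 * t + 3 := by exact_mod_cast (by omega : n ≤ 8 * t + 3)
      have := min_le_right (ε n)⁻¹ (n : ℝ)
      linarith
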